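/- Let $M\in\mathrm{GL}_n(\mathbb{C})$ and let $G(M)$ be the subgroup of $\mathbb{C}^*$ generated by the eigenvalues of $M$. For a subset $X$ of the space $\mathrm{Mat}_n(\mathbb{C})\cong\mathbb{C}^{n^2}$ of complex $n\times n$ matrices, let $\overline{X}$ denote its Zariski closure in $\mathrm{Mat}_n(\mathbb{C})$, and for $A\in\mathrm{GL}_n(\mathbb{C})$ let $\langle A\rangle=\{A^k\mid k\in\mathbb{Z}\}$. If $G(M)$ is torsion-free, then for every nonzero integer $q$ $$\overline{\langle M\rangle}=\overline{\langle M^q\rangle}.$$ -/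

import Mathlib

/-- The coordinate vector in `ℂ ^ (n * n)` of a complex `n × n` matrix. -/
def matrixCoords {n : ℕ} (A : Matrix (Fin n) (Fin n) ℂ) : Fin n × Fin n → ℂ :=
  fun ij => A ij.1 ij.2

/-- A set of matrices is Zariski closed if it is the common zero set of an ideal of polynomials
in the `n * n` matrix entries. -/
def IsZariskiClosed {n : ℕ} (Z : Set (Matrix (Fin n) (Fin n) ℂ)) : Prop :=
  ∃ I : Ideal (MvPolynomial (Fin n × Fin n) ℂ), Z = matrixCoords ⁻¹' MvPolynomial.zeroLocus ℂ I

/-- The Zariski closure of a set `X` of matrices, taken in the space of all complex `n × n`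
matrices: the smallest Zariski closed set containing `X`. -/
def zariskiClosure {n : ℕ} (X : Set (Matrix (Fin n) (Fin n) ℂ)) :
    Set (Matrix (Fin n) (Fin n) ℂ) :=
  ⋂₀ {Z | IsZariskiClosed Z ∧ X ⊆ Z}

/-- The Zariski closure consists of the matrices at which all polynomials vanishing on `X`
vanish. -/
theorem mem_zariskiClosure_iff {n : ℕ} (X : Set (Matrix (Fin n) (Fin n) ℂ))
    (A : Matrix (Fin n) (Fin n) ℂ) :
    A ∈ zariskiClosure X ↔ ∀ p : MvPolynomial (Fin n × Fin n) ℂ,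
      (∀ B ∈ X, MvPolynomial.eval (matrixCoords B) p = 0) →
        MvPolynomial.eval (matrixCoords A) p = 0 := by
  constructor
  · intro h p hp
    have h1 := h (matrixCoords ⁻¹' MvPolynomial.zeroLocus ℂ (Ideal.span {p}))
      ⟨⟨_, rfl⟩, fun B hB => by
        rw [Set.mem_preimage, MvPolynomial.zeroLocus_span]
        simpa [MvPolynomial.coe_aeval_eq_eval] using hp B hB⟩
    rw [Set.mem_preimage, MvPolynomial.zeroLocus_span] at h1
    simpa [MvPolynomial.coe_aeval_eq_eval] using h1
  · rintro h Z ⟨⟨I, rfl⟩, hX⟩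
    rw [Set.mem_preimage, MvPolynomial.mem_zeroLocus_iff]
    intro p hp
    have h1 := h p fun B hB => by
      have h2 := hX hB
      rw [Set.mem_preimage, MvPolynomial.mem_zeroLocus_iff] at h2
      simpa [MvPolynomial.coe_aeval_eq_eval] using h2 p hp
    simpa [MvPolynomial.coe_aeval_eq_eval] using h1

/-- The multiplicative subgroup of `ℂˣ` generated by the nonzero eigenvalues of `M`. -/
def eigenvalueGroup {n : ℕ} (M : Matrix (Fin n) (Fin n) ℂ) : Subgroup ℂˣ :=
  Subgroup.closure {a : ℂˣ | Module.End.HasEigenvalue (Matrix.toLin' M) (a : ℂ)}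

/-- The cyclic subgroup of `GL n ℂ` generated by `M`, as a set of matrices. -/
def cyclicGroupSet {n : ℕ} (M : Matrix.GeneralLinearGroup (Fin n) ℂ) :
    Set (Matrix (Fin n) (Fin n) ℂ) :=
  (fun g : Matrix.GeneralLinearGroup (Fin n) ℂ => (g : Matrix (Fin n) (Fin n) ℂ)) ''
    (Subgroup.zpowers M : Set (Matrix.GeneralLinearGroup (Fin n) ℂ))

/-!
For a polynomial `p` in the matrix entries, the sequence `k ↦ p (M ^ k)` (`k ∈ ℤ`) is a sum of
generalized eigenvectors of the shift operator on `ℤ → ℂ`, with eigenvalues in the group `G`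
generated by the eigenvalues of `M`. Indeed the entries of `M ^ k` are such sums
(`entry_zpow_mem_exponentialPolynomials`), because `ℂ ^ n` is the sum of the generalized
eigenspaces of `M`, and such sums form a ring (`mul_mem_exponentialPolynomials`), because the
product of generalized eigenvectors for `a` and `b` is one for `a * b`.

The claim is therefore that such a sequence `f` vanishes as soon as `k ↦ f (q * k)` does
(`eq_zero_of_dilate_eq_zero`). Dilation by `q` takes generalized eigenvectors for `a` to
generalized eigenvectors for `a ^ q`. As `G` is torsion-free, the `a ^ q` are distinct for
distinct `a ∈ G`, so the independence of generalized eigenspaces shows that the dilation of each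
component of `f` vanishes. On a single generalized eigenspace dilation is injective
(`eq_zero_of_dilate_eq_zero_of_mem_maxGenEigenspace`): with `S` the shift,
`S ^ q - a ^ q` is `S - a` times a factor that is invertible there, since its eigenvalue
`q * a ^ (q - 1)` is nonzero.
-/

/-! ### Shift and dilation of sequences -/

/-- The shift operator on two-sided complex sequences, `f ↦ (k ↦ f (k + 1))`. -/
def shift : Module.End ℂ (ℤ → ℂ) := LinearMap.funLeft ℂ ℂ (· + 1)

/-- Restriction of a two-sided sequence to the multiples of `q`, reindexed by `ℤ`. -/
def dilate (q : ℕ) : Module.End ℂ (ℤ → ℂ) := LinearMap.funLeft ℂ ℂ ((q : ℤ) * ·)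

theorem shift_apply (f : ℤ → ℂ) (k : ℤ) : shift f k = f (k + 1) := rfl

theorem dilate_apply (q : ℕ) (f : ℤ → ℂ) (k : ℤ) : dilate q f k = f (q * k) := rfl

theorem shift_pow_apply (m : ℕ) (f : ℤ → ℂ) (k : ℤ) : (shift ^ m) f k = f (k + m) := by
  induction m generalizing k with
  | zero => simp
  | succ m ih =>
    rw [pow_succ', Module.End.mul_apply, shift_apply, ih]
    congr 1
    push_cast
    ring

theorem shift_mul_dilate (q : ℕ) : shift * dilate q = dilate q * shift ^ q := by
  ext f k
  simp only [Module.End.mul_apply, shift_apply, dilate_apply, shift_pow_apply]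
  congr 1
  ring

theorem sub_smul_one_pow_mul_dilate (q : ℕ) (a : ℂ) (m : ℕ) :
    (shift - a • 1) ^ m * dilate q = dilate q * (shift ^ q - a • 1) ^ m :=
  SemiconjBy.pow_right (a := dilate q) (x := shift ^ q - a • 1) (y := shift - a • 1)
    (by simp [SemiconjBy, mul_sub, sub_mul, shift_mul_dilate]) m |>.symm

theorem smul_one_pow (a : ℂ) (q : ℕ) :
    (a • (1 : Module.End ℂ (ℤ → ℂ))) ^ q = a ^ q • 1 := by
  rw [smul_pow, one_pow]

theorem dilate_mem_maxGenEigenspace (q : ℕ) {a : ℂ} {f : ℤ → ℂ}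
    (hf : f ∈ shift.maxGenEigenspace a) : dilate q f ∈ shift.maxGenEigenspace (a ^ q) := by
  obtain ⟨m, hm⟩ := (Module.End.mem_maxGenEigenspace _ _ _).1 hf
  refine (Module.End.mem_maxGenEigenspace _ _ _).2 ⟨m, ?_⟩
  have hc : Commute shift (a • (1 : Module.End ℂ (ℤ → ℂ))) := (Commute.one_right _).smul_right a
  have hdvd : (shift ^ q - a ^ q • 1) ^ m
      = (∑ i ∈ Finset.range q, shift ^ i * (a • (1 : Module.End ℂ (ℤ → ℂ))) ^ (q - 1 - i)) ^ m
        * (shift - a • 1) ^ m := by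
    rw [← Commute.mul_pow, hc.geom_sum₂_mul, smul_one_pow]
    refine Commute.sum_left _ _ _ fun i _ => Commute.mul_left ?_ ?_
    · exact ((Commute.refl _).sub_right hc).pow_left i
    · rw [smul_one_pow]
      exact (Commute.one_left _).smul_left _
  rw [← Module.End.mul_apply, sub_smul_one_pow_mul_dilate, hdvd, Module.End.mul_apply,
    Module.End.mul_apply, hm, map_zero, map_zero]

/-- Dilation is injective on a generalized eigenspace of the shift with nonzero eigenvalue. -/
theorem eq_zero_of_dilate_eq_zero_of_mem_maxGenEigenspace {q : ℕ} (hq : q ≠ 0) {a : ℂ}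
    (ha : a ≠ 0) {f : ℤ → ℂ} (hf : f ∈ shift.maxGenEigenspace a) (h : dilate q f = 0) :
    f = 0 := by
  obtain ⟨m, hm⟩ := (Module.End.mem_maxGenEigenspace _ _ _).1 hf
  clear hf
  open Polynomial in
  let L : ℂ[X] := X - C a
  let U : ℂ[X] := ∑ i ∈ Finset.range q, X ^ i * C a ^ (q - 1 - i)
  have hL : aeval shift L = shift - a • 1 := by simp [L, Algebra.algebraMap_eq_smul_one]
  have hUL : U * L = X ^ q - C (a ^ q) := by
    rw [C_pow]
    exact (Commute.all _ _).geom_sum₂_mul q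
  have hcop : ∀ m, IsCoprime U (L ^ m) := fun m => by
    refine IsCoprime.pow_right (IsCoprime.symm ?_)
    refine (irreducible_X_sub_C a).coprime_iff_not_dvd.2 ?_
    rw [dvd_iff_isRoot, IsRoot, eval_finsetSum]
    simp only [eval_mul, eval_pow, eval_X, eval_C, geom_sum₂_self]
    exact mul_ne_zero (Nat.cast_ne_zero.2 hq) (pow_ne_zero _ ha)
  rw [← hL, ← map_pow] at hm
  induction m generalizing f with
  | zero => simpa using hm
  | succ m ih =>
    -- With `S` the shift, `(S ^ q - a ^ q) f` is killed by a lower power of `S - a` than `f`, and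
    -- its dilation is `S - a ^ q` applied to the dilation of `f`, hence zero.
    have hg : aeval shift (U * L) f = 0 := by
      refine ih ?_ ?_
      · have h1 := congrArg (· f) (sub_smul_one_pow_mul_dilate q (a ^ q) 1)
        simp only [pow_one, Module.End.mul_apply, h, map_zero] at h1
        rw [hUL, map_sub, map_pow, aeval_X, aeval_C]
        simpa [Algebra.algebraMap_eq_smul_one] using h1.symm
      · rw [← Module.End.mul_apply, ← map_mul, show L ^ m * (U * L) = U * L ^ (m + 1) by ring,
          map_mul, Module.End.mul_apply, hm, map_zero]
    -- `U` is coprime to `L ^ m`, so it can be cancelled and `f` is a geometric sequence.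
    have hLf : aeval shift L f = 0 := by
      refine Submodule.disjoint_def.1 (disjoint_ker_aeval_of_isCoprime shift (hcop m)) _ ?_ ?_
      · rwa [LinearMap.mem_ker, ← Module.End.mul_apply, ← map_mul]
      · rwa [LinearMap.mem_ker, ← Module.End.mul_apply, ← map_mul, ← pow_succ]
    rw [hL] at hLf
    have hstep : ∀ k, f (k + 1) = a * f k := fun k => by
      simpa [shift_apply, sub_eq_zero] using congrFun hLf k
    have h0 : f 0 = 0 := by simpa [dilate_apply] using congrFun h 0
    funext k
    induction k using Int.induction_on with
    | zero => exact h0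
    | succ k hk => rw [hstep, hk]; simp
    | pred k hk =>
      have := hstep (-k - 1)
      rw [sub_add_cancel, hk] at this
      simpa [ha] using this.symm

/-! ### Exponential polynomials -/

/-- The sums of generalized eigenvectors of the shift with eigenvalues in the group `G`, that is,
the sequences `k ↦ ∑ a ∈ G, P_a(k) a ^ k` with polynomials `P_a`. -/
def exponentialPolynomials (G : Subgroup ℂˣ) : Submodule ℂ (ℤ → ℂ) :=
  ⨆ a : G, shift.maxGenEigenspace ((a : ℂˣ) : ℂ)

theorem mem_exponentialPolynomials {G : Subgroup ℂˣ} {a : ℂˣ} (ha : a ∈ G) {f : ℤ → ℂ}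
    (hf : f ∈ shift.maxGenEigenspace (a : ℂ)) : f ∈ exponentialPolynomials G :=
  Submodule.mem_iSup_of_mem (p := fun a : G => shift.maxGenEigenspace ((a : ℂˣ) : ℂ)) ⟨a, ha⟩ hf

theorem const_mem_exponentialPolynomials (G : Subgroup ℂˣ) (c : ℂ) :
    (fun _ => c) ∈ exponentialPolynomials G := by
  refine mem_exponentialPolynomials G.one_mem
    ((Module.End.mem_maxGenEigenspace _ _ _).2 ⟨1, ?_⟩)
  funext k
  simp [shift_apply]

theorem mul_mem_maxGenEigenspace {a b : ℂ} {f g : ℤ → ℂ} (hf : f ∈ shift.maxGenEigenspace a)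
    (hg : g ∈ shift.maxGenEigenspace b) : f * g ∈ shift.maxGenEigenspace (a * b) := by
  obtain ⟨m, hm⟩ := (Module.End.mem_maxGenEigenspace _ _ _).1 hf
  obtain ⟨n, hn⟩ := (Module.End.mem_maxGenEigenspace _ _ _).1 hg
  refine (Module.End.mem_maxGenEigenspace _ _ _).2 ⟨m + n, ?_⟩
  clear hf hg
  generalize hN : m + n = N
  induction N generalizing m n f g with
  | zero =>
    obtain rfl : m = 0 := by omega
    have : f = 0 := by simpa using hm
    simp [this]
  | succ N ih =>
    -- The Leibniz rule for the twisted shifts.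
    have hprod : (shift - (a * b) • 1) (f * g)
        = (shift - a • 1) f * shift g + (a • f) * (shift - b • 1) g := by
      funext k
      simp [shift_apply]
      ring
    have hsg : ((shift - b • 1) ^ n) (shift g) = 0 := by
      have hc : Commute ((shift - b • 1) ^ n) shift :=
        ((Commute.refl _).sub_left ((Commute.one_left _).smul_left b)).pow_left n
      rw [← Module.End.mul_apply, hc.eq, Module.End.mul_apply, hn, map_zero]
    rw [pow_succ, Module.End.mul_apply, hprod, map_add]
    have h1 : ((shift - (a * b) • 1) ^ N) ((shift - a • 1) f * shift g) = 0 := by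
      cases m with
      | zero =>
        have : f = 0 := by simpa using hm
        simp [this]
      | succ m =>
        exact ih m (by rwa [← Module.End.mul_apply, ← pow_succ]) n hsg (by omega)
    have h2 : ((shift - (a * b) • 1) ^ N) ((a • f) * (shift - b • 1) g) = 0 := by
      cases n with
      | zero =>
        have : g = 0 := by simpa using hn
        simp [this]
      | succ n =>
        exact ih m (by rw [map_smul, hm, smul_zero]) n
          (by rwa [← Module.End.mul_apply, ← pow_succ]) (by omega)
    rw [h1, h2, add_zero]

theorem mul_mem_exponentialPolynomials {G : Subgroup ℂˣ} {f g : ℤ → ℂ}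
    (hf : f ∈ exponentialPolynomials G) (hg : g ∈ exponentialPolynomials G) :
    f * g ∈ exponentialPolynomials G := by
  induction hf using Submodule.iSup_induction' with
  | zero => simp
  | add x y _ _ hx hy => rw [add_mul]; exact add_mem hx hy
  | mem a f hf =>
    induction hg using Submodule.iSup_induction' with
    | zero => simp
    | add x y _ _ hx hy => rw [mul_add]; exact add_mem hx hy
    | mem b g hg =>
      refine mem_exponentialPolynomials (mul_mem a.2 b.2) ?_
      rw [Units.val_mul]
      exact mul_mem_maxGenEigenspace hf hg

/-- An exponential polynomial with characteristic roots in a torsion-free group is determined by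
its values at the multiples of a nonzero `q`. -/
theorem eq_zero_of_dilate_eq_zero {G : Subgroup ℂˣ} (hG : IsMulTorsionFree G) {q : ℕ}
    (hq : q ≠ 0) {f : ℤ → ℂ} (hf : f ∈ exponentialPolynomials G) (h : dilate q f = 0) :
    f = 0 := by
  obtain ⟨c, hc, rfl⟩ := (Submodule.mem_iSup_iff_exists_finsupp _ _).1 hf
  have hinj : Function.Injective fun a : G => ((a : ℂˣ) : ℂ) ^ q := fun a b hab => by
    refine hG.pow_left_injective hq (Subtype.ext (Units.ext ?_))
    simpa using hab
  have hind := (Module.End.independent_maxGenEigenspace shift).comp hinj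
  refine Finset.sum_eq_zero fun a ha =>
    eq_zero_of_dilate_eq_zero_of_mem_maxGenEigenspace hq (Units.ne_zero _) (hc a) ?_
  refine (iSupIndep_iff_finsetSum_eq_zero_imp_eq_zero _).1 hind c.support (fun a => dilate q (c a))
    (fun a _ => dilate_mem_maxGenEigenspace q (hc a)) ?_ a ha
  rw [← map_sum]
  exact h

/-! ### Powers of a matrix -/

/-- A scalar with a nonzero generalized eigenvector for the invertible matrix `M` is an eigenvalue,
hence nonzero, and so comes from the eigenvalue group. -/
theorem exists_mem_eigenvalueGroup {n : ℕ} (M : Matrix.GeneralLinearGroup (Fin n) ℂ) {μ : ℂ}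
    {v : Fin n → ℂ} (hv : v ≠ 0)
    (hμ : v ∈ Module.End.maxGenEigenspace (Matrix.toLin' (M : Matrix (Fin n) (Fin n) ℂ)) μ) :
    ∃ a ∈ eigenvalueGroup (M : Matrix (Fin n) (Fin n) ℂ), (a : ℂ) = μ := by
  have hE : Module.End.HasEigenvalue (Matrix.toLin' (M : Matrix (Fin n) (Fin n) ℂ)) μ := by
    have : Module.End.HasUnifEigenvalue (Matrix.toLin' (M : Matrix (Fin n) (Fin n) ℂ)) μ ⊤ :=
      (Submodule.ne_bot_iff _).2 ⟨v, hμ, hv⟩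
    exact this.lt zero_lt_one
  have h0 : μ ≠ 0 := by
    rintro rfl
    obtain ⟨w, hw⟩ := hE.exists_hasEigenvector
    refine hw.2 ?_
    have := hw.apply_eq_smul
    rw [zero_smul, Matrix.toLin'_apply] at this
    have h2 := congrArg (Matrix.mulVec ((M⁻¹ : Matrix.GeneralLinearGroup (Fin n) ℂ) :
      Matrix (Fin n) (Fin n) ℂ)) this
    simpa [Matrix.mulVec_mulVec, ← Units.val_mul] using h2
  exact ⟨Units.mk0 μ h0, Subgroup.subset_closure hE, rfl⟩

/-- The linear map sending a vector `v` to the sequence of `i`-th coordinates of `M ^ k v`. -/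
def orbitCoord {n : ℕ} (M : Matrix.GeneralLinearGroup (Fin n) ℂ) (i : Fin n) :
    (Fin n → ℂ) →ₗ[ℂ] (ℤ → ℂ) :=
  LinearMap.pi fun k : ℤ =>
    LinearMap.proj i ∘ₗ
      Matrix.toLin' ((M ^ k : Matrix.GeneralLinearGroup (Fin n) ℂ) : Matrix (Fin n) (Fin n) ℂ)

theorem shift_orbitCoord {n : ℕ} (M : Matrix.GeneralLinearGroup (Fin n) ℂ) (i : Fin n)
    (v : Fin n → ℂ) : shift (orbitCoord M i v)
      = orbitCoord M i (Matrix.toLin' (M : Matrix (Fin n) (Fin n) ℂ) v) := by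
  funext k
  have h : ((M ^ (k + 1) : Matrix.GeneralLinearGroup (Fin n) ℂ) : Matrix (Fin n) (Fin n) ℂ)
      = (M ^ k : Matrix.GeneralLinearGroup (Fin n) ℂ) * M := by
    rw [zpow_add_one, Units.val_mul]
  simp only [orbitCoord, shift_apply, LinearMap.pi_apply, LinearMap.comp_apply,
    LinearMap.proj_apply, Matrix.toLin'_apply, Matrix.mulVec_mulVec, h]

theorem orbitCoord_mem_maxGenEigenspace {n : ℕ} (M : Matrix.GeneralLinearGroup (Fin n) ℂ)
    (i : Fin n) {μ : ℂ} {v : Fin n → ℂ}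
    (hv : v ∈ Module.End.maxGenEigenspace (Matrix.toLin' (M : Matrix (Fin n) (Fin n) ℂ)) μ) :
    orbitCoord M i v ∈ shift.maxGenEigenspace μ := by
  obtain ⟨m, hm⟩ := (Module.End.mem_maxGenEigenspace _ _ _).1 hv
  refine (Module.End.mem_maxGenEigenspace _ _ _).2 ⟨m, ?_⟩
  clear hv
  induction m generalizing v with
  | zero =>
    have : v = 0 := by simpa using hm
    simp [this]
  | succ m ih =>
    rw [pow_succ, Module.End.mul_apply] at hm ⊢
    have : (shift - μ • 1) (orbitCoord M i v)
        = orbitCoord M i ((Matrix.toLin' (M : Matrix (Fin n) (Fin n) ℂ) - μ • 1) v) := by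
      simp only [LinearMap.sub_apply, LinearMap.smul_apply, Module.End.one_apply, map_sub,
        map_smul, shift_orbitCoord]
    rw [this]
    exact ih hm

theorem orbitCoord_mem_exponentialPolynomials {n : ℕ}
    (M : Matrix.GeneralLinearGroup (Fin n) ℂ) (i : Fin n) (v : Fin n → ℂ) :
    orbitCoord M i v
      ∈ exponentialPolynomials (eigenvalueGroup (M : Matrix (Fin n) (Fin n) ℂ)) := by
  have hv : v ∈ ⨆ μ,
      Module.End.maxGenEigenspace (Matrix.toLin' (M : Matrix (Fin n) (Fin n) ℂ)) μ := by
    rw [Module.End.iSup_maxGenEigenspace_eq_top]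
    trivial
  induction hv using Submodule.iSup_induction' with
  | zero => simp
  | add x y _ _ hx hy => rw [map_add]; exact add_mem hx hy
  | mem μ v hv =>
    obtain rfl | h0 := eq_or_ne v 0
    · simp
    · obtain ⟨a, ha, rfl⟩ := exists_mem_eigenvalueGroup M h0 hv
      exact mem_exponentialPolynomials ha (orbitCoord_mem_maxGenEigenspace M i hv)

theorem entry_zpow_mem_exponentialPolynomials {n : ℕ}
    (M : Matrix.GeneralLinearGroup (Fin n) ℂ) (i j : Fin n) :
    (fun k : ℤ =>
        ((M ^ k : Matrix.GeneralLinearGroup (Fin n) ℂ) : Matrix (Fin n) (Fin n) ℂ) i j)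
      ∈ exponentialPolynomials (eigenvalueGroup (M : Matrix (Fin n) (Fin n) ℂ)) := by
  convert orbitCoord_mem_exponentialPolynomials M i (Pi.single j 1) using 1
  funext k
  simp [orbitCoord]

theorem eval_zpow_mem_exponentialPolynomials {n : ℕ}
    (M : Matrix.GeneralLinearGroup (Fin n) ℂ) (p : MvPolynomial (Fin n × Fin n) ℂ) :
    (fun k : ℤ => MvPolynomial.eval (matrixCoords
        ((M ^ k : Matrix.GeneralLinearGroup (Fin n) ℂ) : Matrix (Fin n) (Fin n) ℂ)) p)
      ∈ exponentialPolynomials (eigenvalueGroup (M : Matrix (Fin n) (Fin n) ℂ)) := by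
  induction p using MvPolynomial.induction_on with
  | C c => simpa using const_mem_exponentialPolynomials _ c
  | add p r hp hr => simpa using! add_mem hp hr
  | mul_X p ij hp =>
    simpa using! mul_mem_exponentialPolynomials hp
      (entry_zpow_mem_exponentialPolynomials M ij.1 ij.2)

theorem zariskiClosure_mono {n : ℕ} {X Y : Set (Matrix (Fin n) (Fin n) ℂ)} (h : X ⊆ Y) :
    zariskiClosure X ⊆ zariskiClosure Y :=
  Set.sInter_subset_sInter fun _ hZ => ⟨hZ.1, h.trans hZ.2⟩

theorem mainTheorem9 (n : ℕ) (M : Matrix.GeneralLinearGroup (Fin n) ℂ)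
    (hM : IsMulTorsionFree (eigenvalueGroup (M : Matrix (Fin n) (Fin n) ℂ)))
    (q : ℤ) (hq : q ≠ 0) :
    zariskiClosure (cyclicGroupSet M) = zariskiClosure (cyclicGroupSet (M ^ q)) := by
  refine Set.Subset.antisymm (fun A hA => ?_)
    (zariskiClosure_mono (Set.image_mono (Subgroup.zpowers_le.2 (Subgroup.zpow_mem_zpowers M q))))
  rw [mem_zariskiClosure_iff] at hA ⊢
  refine fun p hp => hA p ?_
  rintro _ ⟨_, ⟨k, rfl⟩, rfl⟩
  refine congrFun (eq_zero_of_dilate_eq_zero hM (Int.natAbs_ne_zero.2 hq)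
    (eval_zpow_mem_exponentialPolynomials M p) (funext fun j => ?_)) k
  refine hp _ ⟨_, ?_, rfl⟩
  -- `|q|` is a multiple of `q`, so `M ^ (|q| * j)` is a power of `M ^ q`.
  obtain ⟨r, hr⟩ := Int.dvd_natAbs_self (a := q)
  exact ⟨r * j, by simp only [← zpow_mul, hr, mul_assoc]⟩
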